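/- Let $k$ be an infinite field, $n\ge 0$ an integer, $S=k[x_1,\dots,x_n]$, and let $I\subseteq S$ be a monomial ideal (an ideal generated by monomials). Then the following are equivalent: (1) $I$ is of Borel type, that is, $I:(x_1,\dots,x_i)^\infty=I:x_i^\infty$ for all $i=1,\dots,n$, where $I:J^\infty=\bigcup_{t\ge 0}(I:J^t)$. (2) $x_n,x_{n-1},\dots,x_1$ is an almost regular sequence on $S/I$, where a sequence $y_1,\dots,y_r$ in $S$ is called almost regular on an $S$-module $M$ if, for every $j=1,\dots,r$, the submodule $\{m\in M/(y_1,\dots,y_{j-1})M : y_j m=0\}$ has finite length. (3) For every $i=1,\dots,n$ the first Koszul homology module $H_1(x_n,x_{n-1},\dots,x_i;S/I)$ has finite length as an $S$-module. (4) For all sufficiently large integers $e$ the ideal $I_{\ge e}$, generated by the monomials of degree at least $e$ in $I$, is stable. Here a monomial ideal $L$ is called stable if for every monomial $u\in L$ with $u\ne 1$ and every $i<m$, where $m=\max\{j : x_j \text{ divides } u\}$, one has $x_i\,u/x_m\in L$. -/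

import Mathlib

namespace BorelTypeIdeals

section Koszul

variable {R : Type*} [CommRing R] {ι : Type*} [LinearOrder ι]

/-- The degree `p` term of the Koszul complex of a finite family indexed by `ι` with
coefficients in `M`: the direct sum of copies of `M` indexed by the `p`-element subsets of `ι`.
The function `f` stands for the sum over `s = {i₁ < ⋯ < i_p}` of the terms
`f s • (e_{i₁} ∧ ⋯ ∧ e_{i_p})`. -/
abbrev KoszulTerm (ι : Type*) (M : Type*) (p : ℕ) : Type _ :=
  {s : Finset ι // s.card = p} → M

/-- The sign `(-1) ^ #{t ∈ s | t < j}`. -/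
def koszulSign (s : Finset ι) (j : ι) : ℤ :=
  (-1) ^ (s.filter (fun t => t < j)).card

theorem koszulSign_swap (s : Finset ι) {i j : ι} (hi : i ∉ s) (hj : j ∉ s) (hij : i ≠ j) :
    koszulSign s i * koszulSign (insert i s) j = -(koszulSign s j * koszulSign (insert j s) i) := by
  unfold koszulSign
  rw [Finset.filter_insert, Finset.filter_insert]
  rcases lt_or_gt_of_ne hij with h | h
  · rw [if_pos h, if_neg h.not_gt, Finset.card_insert_of_notMem (by simp [hi])]
    ring
  · rw [if_neg h.not_gt, if_pos h, Finset.card_insert_of_notMem (by simp [hj])]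
    ring

variable [Fintype ι]

/-- The Koszul differential from degree `p + 1` to degree `p`, determined by
`e_{i₁} ∧ ⋯ ∧ e_{i_{p+1}} ↦ ∑ q, (-1) ^ (q - 1) • y_{i_q} • (e_{i₁} ∧ ⋯ omit e_{i_q} ⋯ ∧ e_{i_{p+1}})`;
it is written here through its coefficient at each `p`-element subset `s`. -/
def koszulD (y : ι → R) (M : Type*) [AddCommGroup M] [Module R M] (p : ℕ) :
    KoszulTerm ι M (p + 1) →ₗ[R] KoszulTerm ι M p where
  toFun f s := ∑ j : {j : ι // j ∉ s.1}, koszulSign s.1 j.1 •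
    (y j.1 • f ⟨insert j.1 s.1, by rw [Finset.card_insert_of_notMem j.2, s.2]⟩)
  map_add' f g := by
    funext s
    simp [smul_add, Finset.sum_add_distrib]
  map_smul' c f := by
    funext s
    simp only [Pi.smul_apply, RingHom.id_apply, Finset.smul_sum]
    refine Finset.sum_congr rfl fun j _ => ?_
    rw [smul_comm c, smul_comm c]

/-- Two consecutive Koszul differentials compose to zero. -/
theorem koszulD_comp_koszulD (y : ι → R) (M : Type*) [AddCommGroup M] [Module R M] (p : ℕ) :
    koszulD y M p ∘ₗ koszulD y M (p + 1) = 0 := by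
  refine LinearMap.ext fun f => ?_
  funext s
  simp only [LinearMap.comp_apply, koszulD, LinearMap.coe_mk, AddHom.coe_mk, LinearMap.zero_apply,
    Pi.zero_apply, Finset.smul_sum]
  rw [Finset.sum_sigma']
  refine Finset.sum_involution (fun x _ => ⟨⟨x.2.1, fun h => x.2.2 (by simp [h])⟩,
    ⟨x.1.1, fun h => by
      rcases Finset.mem_insert.1 h with h | h
      · exact x.2.2 (by simp [h])
      · exact x.1.2 h⟩⟩) ?_ ?_ ?_ ?_
  · rintro ⟨⟨i, hi⟩, ⟨j, hj⟩⟩ -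
    have hij : i ≠ j := fun h => hj (by simp [h])
    have hjs : j ∉ s.1 := fun h => hj (by simp [h])
    simp only [Finset.insert_comm j i, smul_comm (y _) (koszulSign _ _), smul_smul,
      koszulSign_swap s.1 hi hjs hij, mul_comm (y j) (y i), neg_smul, neg_add_cancel]
  · rintro ⟨⟨i, hi⟩, ⟨j, hj⟩⟩ - - h
    have hij : i ≠ j := fun h => hj (by simp [h])
    simp only [Sigma.mk.injEq, Subtype.mk.injEq] at h
    exact hij h.1.symm
  · intros; simp
  · rintro ⟨⟨i, hi⟩, ⟨j, hj⟩⟩ -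
    rfl

/-- The cycles in degree `p` of the Koszul complex; everything is a cycle in degree `0`. -/
def koszulCycles (y : ι → R) (M : Type*) [AddCommGroup M] [Module R M] :
    (p : ℕ) → Submodule R (KoszulTerm ι M p)
  | 0 => ⊤
  | p + 1 => LinearMap.ker (koszulD y M p)

/-- The boundaries in degree `p` of the Koszul complex. -/
def koszulBoundaries (y : ι → R) (M : Type*) [AddCommGroup M] [Module R M] (p : ℕ) :
    Submodule R (KoszulTerm ι M p) :=
  LinearMap.range (koszulD y M p)

/-- The Koszul homology `H_p(y; M)`: cycles modulo boundaries. -/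
abbrev KoszulHomology (y : ι → R) (M : Type*) [AddCommGroup M] [Module R M] (p : ℕ) : Type _ :=
  koszulCycles y M p ⧸ (koszulBoundaries y M p).submoduleOf (koszulCycles y M p)

end Koszul

/-- The sequence `y_0, …, y_{r-1}` is almost regular on `M`: for each `i`, the submodule of
elements of `M / (y_0, …, y_{i-1}) M` annihilated by `y_i` has finite length. -/
def IsAlmostRegularSeq {R : Type*} [CommRing R] (M : Type*) [AddCommGroup M] [Module R M]
    {r : ℕ} (y : Fin r → R) : Prop :=
  ∀ i : Fin r, IsFiniteLength R
    (Submodule.torsionBy R (M ⧸ (Ideal.span (y '' Set.Iio i) • (⊤ : Submodule R M))) (y i))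

/-- The saturation `I : J^∞`, the increasing union of the ideals `I : J^t`. -/
def saturation {R : Type*} [CommRing R] (I J : Ideal R) : Ideal R :=
  ⨆ t : ℕ, Submodule.colon I ((J ^ t : Ideal R) : Set R)

section Monomial

variable {k : Type*} [Field k] {n : ℕ}

/-- An ideal of the polynomial ring generated by monomials. -/
def IsMonomialIdeal (I : Ideal (MvPolynomial (Fin n) k)) : Prop :=
  ∃ A : Set (Fin n →₀ ℕ), I = Ideal.span ((fun a => MvPolynomial.monomial a (1 : k)) '' A)

/-- Borel type: `I : (x_1, …, x_i)^∞ = I : x_i^∞` for all `i`. The variables `x_1, …, x_n` are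
`X 0, …, X (n - 1)`. -/
def IsBorelType (I : Ideal (MvPolynomial (Fin n) k)) : Prop :=
  ∀ i : Fin n, saturation I (Ideal.span (MvPolynomial.X '' Set.Iic i)) =
    saturation I (Ideal.span {MvPolynomial.X i})

/-- Stability of a monomial ideal: for each monomial `u ∈ I` other than `1`, with `m` the largest
index such that `x_m` divides `u`, and each `i < m`, one has `x_i (u / x_m) ∈ I`. -/
def IsStable (I : Ideal (MvPolynomial (Fin n) k)) : Prop :=
  ∀ a : Fin n →₀ ℕ, MvPolynomial.monomial a (1 : k) ∈ I →
    ∀ m : Fin n, IsGreatest {j : Fin n | a j ≠ 0} m → ∀ i : Fin n, i < m →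
      MvPolynomial.monomial (Finsupp.single i 1 + (a - Finsupp.single m 1)) (1 : k) ∈ I

/-- The truncation `I_{≥ e}`: the ideal generated by the monomials of degree `≥ e` in `I`. -/
noncomputable def truncation (I : Ideal (MvPolynomial (Fin n) k)) (e : ℕ) : Ideal (MvPolynomial (Fin n) k) :=
  Ideal.span {f | ∃ a : Fin n →₀ ℕ, e ≤ a.degree ∧ f = MvPolynomial.monomial a (1 : k) ∧ f ∈ I}

/-- The sequence of variables `X (n - 1), X (n - 2), …, X i`, of length `n - i`; in the
numbering `x_1, …, x_n` this is `x_n, …, x_{i+1}`. For `i = 0` it is `x_n, …, x_1`. -/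
noncomputable def descVars (k : Type*) [Field k] (n i : ℕ) :
    Fin (n - i) → MvPolynomial (Fin n) k :=
  fun j => MvPolynomial.X (Fin.rev (Fin.castLE (Nat.sub_le n i) j))

end Monomial

end BorelTypeIdeals

/-!
For a monomial ideal `I`, each condition is a statement about the set `A` of exponents of monomials
in `I`. The pivot is the set `socleSet A m` of exponents `b ∉ A` that involve only variables `≤ m`
and satisfy `b + e_m ∈ A`: these monomials form a `k`-basis of the annihilator of `x_m` in
`S / (I + (x_l : l > m))`. Over `S` this annihilator has finite length if and only if the basis is
finite (`isFiniteLength_torsionBy_X_iff`): a finite-dimensional space is both Artinian and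
Noetherian, and conversely the powers of `(x_1, …, x_n)` cut a descending chain that stabilizes only
if the degrees in the basis are bounded. So almost regularity of `x_n, …, x_1` says that all socle
sets are finite.

The rest of the equivalence of Borel type, almost regularity and stability is combinatorial.
* Borel type implies finite socle sets (`finite_socleSet_of_forall_exists`): if for each `j ≤ m` some
  power of `x_j` multiplies `x ^ b` into `I`, then each exponent `b j` is smaller than the `j`-th
  exponent of one of the minimal generators, of which there are finitely many by Dickson's lemma.
* Finite socle sets imply stability in degrees above all socle degrees
  (`exists_degree_bound_of_finite_socleSet`), since there `x ^ a / x_m` is itself in `I`.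
* Stability in large degrees implies Borel type (`exists_add_single_mem_of_exchange`): exchange
  repeatedly the largest variable for `x_j`.

The equivalence of almost regularity with finite length of the Koszul homology `H_1` holds for every
sequence and module over a commutative ring (`isAlmostRegularSeq_iff_koszulHomology`), by induction
along the exact sequence
`H_1(y_0, …, y_{r-1}; M) → H_1(y_0, …, y_r; M) → 0 :_{M / (y_0, …, y_{r-1}) M} y_r → 0`.
-/

namespace BorelTypeIdeals

/-! ### Upper sets of exponents -/

section Exponents

variable {n : ℕ} {A : Set (Fin n →₀ ℕ)}

/-- The exponents `b` of the monomials in the variables `≤ m` that lie outside `A` and are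
multiplied into `A` by the variable `m`. -/
def socleSet (A : Set (Fin n →₀ ℕ)) (m : Fin n) : Set (Fin n →₀ ℕ) :=
  {b | b ∉ A ∧ (∀ l, m < l → b l = 0) ∧ b + Finsupp.single m 1 ∈ A}

/-- Only finitely many monomials in the variables `≤ m` lie outside a monomial ideal and are
multiplied into it by a power of each of these variables: if a minimal generator `g` divides
`x ^ b * x_j ^ s` but not `x ^ b`, then `b j < g j`, and there are finitely many such `g`. -/
theorem finite_notMem_of_forall_add_single_mem (hA : IsUpperSet A) (m : Fin n) :
    {b : Fin n →₀ ℕ | b ∉ A ∧ (∀ l, m < l → b l = 0) ∧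
      ∀ j ≤ m, ∃ s, b + Finsupp.single j s ∈ A}.Finite := by
  have hfin : {g | Minimal (· ∈ A) g}.Finite :=
    WellQuasiOrderedLE.finite_of_isAntichain (setOfPred_minimal_antichain _)
  obtain ⟨c, hc⟩ := hfin.bddAbove
  refine (Set.finite_Iic c).subset ?_
  rintro b ⟨hb, hl, hj⟩ j
  rcases lt_or_ge m j with h | h
  · simp [hl j h]
  obtain ⟨s, hs⟩ := hj j h
  obtain ⟨g, hgle, hg⟩ := exists_minimal_le_of_wellFoundedLT (· ∈ A) _ hs
  by_contra! hlt
  refine hb (hA (fun i => ?_) hg.prop)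
  by_cases hi : i = j
  · subst hi
    exact (hc hg i).trans hlt.le
  · have := hgle i
    simpa [Finsupp.single_apply, Ne.symm hi] using this

theorem finite_socleSet_of_forall_exists (hA : IsUpperSet A)
    (h : ∀ (i : Fin n) (a : Fin n →₀ ℕ), (∃ t, a + Finsupp.single i t ∈ A) →
      ∀ j ≤ i, ∃ s, a + Finsupp.single j s ∈ A) (m : Fin n) : (socleSet A m).Finite :=
  (finite_notMem_of_forall_add_single_mem hA m).subset
    fun b hb => ⟨hb.1, hb.2.1, h m b ⟨1, hb.2.2⟩⟩

/-- Above the degrees of all socle monomials, the exchange `x_m ↦ x_i` stays in the ideal because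
`x ^ a / x_m` already does. -/
theorem exists_degree_bound_of_finite_socleSet (hA : IsUpperSet A)
    (h : ∀ m, (socleSet A m).Finite) :
    ∃ e : ℕ, ∀ a ∈ A, e ≤ a.degree → ∀ m : Fin n, IsGreatest {j : Fin n | a j ≠ 0} m →
      ∀ i < m, Finsupp.single i 1 + (a - Finsupp.single m 1) ∈ A := by
  obtain ⟨d, hd⟩ := ((Set.finite_iUnion h).image Finsupp.degree).bddAbove
  refine ⟨d + 2, fun a ha hdeg m hm i _ => ?_⟩
  have hle : Finsupp.single m 1 ≤ a := by
    simpa [Nat.one_le_iff_ne_zero] using hm.1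
  have hsub : a - Finsupp.single m 1 + Finsupp.single m 1 = a := tsub_add_cancel_of_le hle
  by_cases hmem : a - Finsupp.single m 1 ∈ A
  · exact hA le_add_self hmem
  exfalso
  have hsoc : a - Finsupp.single m 1 ∈ socleSet A m := by
    refine ⟨hmem, fun l hl => ?_, hsub.symm ▸ ha⟩
    have : a l = 0 := by
      by_contra h0
      exact (hm.2 h0).not_gt hl
    simp [this]
  have h1 := hd ⟨_, Set.mem_iUnion.2 ⟨m, hsoc⟩, rfl⟩
  have h2 := congrArg Finsupp.degree hsub
  rw [map_add, Finsupp.degree_single] at h2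
  omega

/-- Starting from `a` and exchanging the largest variable for `x_j` as long as it is `≥ i`, one
removes all variables `≥ i`. -/
theorem exists_mem_of_exchange {e : ℕ} (h : ∀ a ∈ A, e ≤ a.degree → ∀ m : Fin n,
      IsGreatest {j : Fin n | a j ≠ 0} m →
      ∀ i < m, Finsupp.single i 1 + (a - Finsupp.single m 1) ∈ A)
    {i j : Fin n} (hj : j < i) (N : ℕ) (a : Fin n →₀ ℕ) (ha : a ∈ A) (hdeg : e ≤ a.degree)
    (hN : ∑ l ∈ Finset.Ici i, a l = N) :
    ∃ b ∈ A, (∀ l, i ≤ l → b l = 0) ∧ ∀ l < i, l ≠ j → b l = a l := by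
  induction N generalizing a with
  | zero =>
    rw [Finset.sum_eq_zero_iff] at hN
    exact ⟨a, ha, fun l hl => hN l (Finset.mem_Ici.2 hl), fun _ _ _ => rfl⟩
  | succ N ih =>
    have hne : {j : Fin n | a j ≠ 0}.Nonempty := by
      by_contra hempty
      have : ∀ l, a l = 0 := fun l => by
        by_contra h0
        exact hempty ⟨l, h0⟩
      simp [this] at hN
    obtain ⟨m, hm⟩ := (Set.toFinite {j : Fin n | a j ≠ 0}).exists_maximal hne
    have hgr : IsGreatest {j : Fin n | a j ≠ 0} m := ⟨hm.prop, fun l hl => not_lt.1 (hm.not_gt hl)⟩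
    have him : i ≤ m := by
      by_contra! hlt
      have : ∀ l ∈ Finset.Ici i, a l = 0 := fun l hl => by
        by_contra h0
        exact (hgr.2 h0).not_gt (hlt.trans_le (Finset.mem_Ici.1 hl))
      rw [Finset.sum_eq_zero this] at hN
      omega
    have hle : Finsupp.single m 1 ≤ a := by
      simpa [Nat.one_le_iff_ne_zero] using hgr.1
    set c := a - Finsupp.single m 1 with hc
    have hsub : c + Finsupp.single m 1 = a := tsub_add_cancel_of_le hle
    obtain ⟨b, hb, hb0, hba⟩ := ih (Finsupp.single j 1 + c) (h a ha hdeg m hgr j (hj.trans_le him))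
      (by
        rw [← hsub, map_add, Finsupp.degree_single] at hdeg
        rw [map_add, Finsupp.degree_single]
        omega)
      (by
        have h1 : ∑ l ∈ Finset.Ici i, Finsupp.single m 1 l = 1 := by
          simp [Finsupp.single_apply, him]
        have h2 : ∑ l ∈ Finset.Ici i, Finsupp.single j 1 l = 0 := by
          simp [Finsupp.single_apply, hj]
        rw [← hsub] at hN
        simp only [Finsupp.add_apply, Finset.sum_add_distrib, h1, h2] at hN ⊢
        omega)
    refine ⟨b, hb, hb0, fun l hl hlj => (hba l hl hlj).trans ?_⟩
    have hlm : m ≠ l := (hl.trans_le him).ne'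
    simp [hc, hlj.symm, hlm]

/-- Stability in large degrees gives the Borel type condition: multiply `x ^ a * x_i ^ t` by a power
of `x_j` to reach a large degree, then exchange all variables `≥ i` for `x_j`; what remains divides
`x ^ a * x_j ^ s`. -/
theorem exists_add_single_mem_of_exchange (hA : IsUpperSet A) {e : ℕ}
    (h : ∀ a ∈ A, e ≤ a.degree → ∀ m : Fin n, IsGreatest {j : Fin n | a j ≠ 0} m →
      ∀ i < m, Finsupp.single i 1 + (a - Finsupp.single m 1) ∈ A)
    (i : Fin n) (a : Fin n →₀ ℕ) (ha : ∃ t, a + Finsupp.single i t ∈ A) (j : Fin n) (hj : j ≤ i) :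
    ∃ s, a + Finsupp.single j s ∈ A := by
  obtain ⟨t, ht⟩ := ha
  rcases hj.eq_or_lt with rfl | hj
  · exact ⟨t, ht⟩
  obtain ⟨b, hb, hb0, hba⟩ := exists_mem_of_exchange h hj _ (a + Finsupp.single i t +
    Finsupp.single j e) (hA le_self_add ht) (by simp) rfl
  refine ⟨b j, hA (fun l => ?_) hb⟩
  by_cases hlj : l = j
  · simp [hlj]
  rcases le_or_gt i l with hl | hl
  · simp [hb0 l hl]
  · rw [hba l hl hlj]
    simp [hl.ne', Ne.symm hlj]

end Exponents

/-! ### Monomial ideals and their sets of exponents -/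

section Translation

open MvPolynomial

variable {k : Type*} [Field k] {n : ℕ} {I : Ideal (MvPolynomial (Fin n) k)}

/-- The exponents of the monomials in `I`. -/
def exponents (I : Ideal (MvPolynomial (Fin n) k)) : Set (Fin n →₀ ℕ) :=
  {a | monomial a (1 : k) ∈ I}

theorem isUpperSet_exponents (I : Ideal (MvPolynomial (Fin n) k)) : IsUpperSet (exponents I) := by
  intro a b hab ha
  have h : monomial b (1 : k) = monomial (b - a) 1 * monomial a 1 := by
    rw [monomial_mul, tsub_add_cancel_of_le hab, one_mul]
  rw [exponents, Set.mem_ofPred_eq, h]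
  exact I.mul_mem_left _ ha

/-- Membership in a monomial ideal is decided monomial by monomial. -/
theorem IsMonomialIdeal.mem_iff (hI : IsMonomialIdeal I) (f : MvPolynomial (Fin n) k) :
    f ∈ I ↔ ∀ a ∈ f.support, a ∈ exponents I := by
  classical
  obtain ⟨A, rfl⟩ := hI
  rw [mem_ideal_span_monomial_image]
  refine forall₂_congr fun a _ => ?_
  rw [exponents, Set.mem_ofPred_eq, mem_ideal_span_monomial_image, support_monomial, if_neg one_ne_zero]
  simp

theorem monomial_mul_X_pow (a : Fin n →₀ ℕ) (i : Fin n) (t : ℕ) :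
    monomial a (1 : k) * X i ^ t = monomial (a + Finsupp.single i t) 1 := by
  rw [X_pow_eq_monomial, monomial_mul, one_mul]

theorem forall_mem_support_mul_X_pow {p : (Fin n →₀ ℕ) → Prop} (f : MvPolynomial (Fin n) k)
    (i : Fin n) (t : ℕ) :
    (∀ a ∈ (f * X i ^ t).support, p a) ↔ ∀ a ∈ f.support, p (a + Finsupp.single i t) := by
  rw [X_pow_eq_monomial]
  constructor
  · intro h a ha
    refine h _ ?_
    rw [mem_support_iff, coeff_mul_monomial, mul_one]
    exact mem_support_iff.1 ha
  · intro h a ha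
    rw [mem_support_iff, coeff_mul_monomial'] at ha
    by_cases hle : Finsupp.single i t ≤ a
    · rw [if_pos hle, mul_one] at ha
      have := h _ (mem_support_iff.2 ha)
      rwa [tsub_add_cancel_of_le hle] at this
    · simp [hle] at ha

/-! ### Saturations -/

theorem mem_saturation_iff {R : Type*} [CommRing R] {I J : Ideal R} {f : R} :
    f ∈ saturation I J ↔ ∃ t, ∀ p ∈ J ^ t, f * p ∈ I := by
  have hmono : Monotone fun t : ℕ => Submodule.colon I ((J ^ t : Ideal R) : Set R) :=
    fun s t hst => Submodule.colon_mono le_rfl (Ideal.pow_le_pow_right hst)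
  rw [saturation, Submodule.mem_iSup_of_directed _ hmono.directed_le]
  simp [Submodule.mem_colon]

theorem mem_saturation_span_singleton_iff {R : Type*} [CommRing R] {I : Ideal R} {f x : R} :
    f ∈ saturation I (Ideal.span {x}) ↔ ∃ t, f * x ^ t ∈ I := by
  rw [mem_saturation_iff]
  refine exists_congr fun t => ?_
  rw [Ideal.span_singleton_pow]
  refine ⟨fun h => h _ (Ideal.mem_span_singleton_self _), fun h p hp => ?_⟩
  obtain ⟨q, rfl⟩ := Ideal.mem_span_singleton'.1 hp
  rw [mul_left_comm]
  exact I.mul_mem_left _ h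

/-- Membership in `I : (x_1, …, x_i)^∞` may be tested on powers of each generator separately. -/
theorem mem_saturation_span_iff {R : Type*} [CommRing R] {I : Ideal R} {f : R} {s : Set R}
    (hs : s.Finite) : f ∈ saturation I (Ideal.span s) ↔ ∀ x ∈ s, ∃ t, f * x ^ t ∈ I := by
  rw [mem_saturation_iff]
  constructor
  · rintro ⟨t, ht⟩ x hx
    exact ⟨t, ht _ (Ideal.pow_mem_pow (Ideal.subset_span hx) t)⟩
  · intro h
    have hle : Ideal.span s ≤ (I.colon {f}).radical := by
      rw [Ideal.span_le]
      intro x hx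
      obtain ⟨t, ht⟩ := h x hx
      refine ⟨t, ?_⟩
      rw [Submodule.mem_colon_singleton, smul_eq_mul, mul_comm]
      exact ht
    obtain ⟨t, ht⟩ := Ideal.exists_pow_le_of_le_radical_of_fg hle (Submodule.fg_span hs)
    refine ⟨t, fun p hp => ?_⟩
    have := ht hp
    rwa [Submodule.mem_colon_singleton, smul_eq_mul, mul_comm] at this

/-- A monomial ideal is of Borel type if and only if every monomial that a power of `x_i` multiplies
into `I` is also multiplied into `I` by a power of each `x_j` with `j ≤ i`. -/
theorem isBorelType_iff (hI : IsMonomialIdeal I) :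
    IsBorelType I ↔ ∀ (i : Fin n) (a : Fin n →₀ ℕ),
      (∃ t, a + Finsupp.single i t ∈ exponents I) →
        ∀ j ≤ i, ∃ s, a + Finsupp.single j s ∈ exponents I := by
  have hfin : ∀ i : Fin n, ((X '' Set.Iic i : Set (MvPolynomial (Fin n) k))).Finite :=
    fun i => Set.toFinite _
  constructor
  · rintro h i a ⟨t, ht⟩ j hj
    have hmem : monomial a (1 : k) ∈ saturation I (Ideal.span (X '' Set.Iic i)) := by
      rw [h i, mem_saturation_span_singleton_iff]
      exact ⟨t, by rw [monomial_mul_X_pow]; exact ht⟩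
    obtain ⟨s, hs⟩ := (mem_saturation_span_iff (hfin i)).1 hmem (X j) ⟨j, hj, rfl⟩
    rw [monomial_mul_X_pow] at hs
    exact ⟨s, hs⟩
  · intro h i
    refine le_antisymm (fun f hf => ?_) (fun f hf => ?_)
    · exact mem_saturation_span_singleton_iff.2
        ((mem_saturation_span_iff (hfin i)).1 hf (X i) ⟨i, Set.mem_Iic.2 le_rfl, rfl⟩)
    · obtain ⟨t, ht⟩ := mem_saturation_span_singleton_iff.1 hf
      rw [hI.mem_iff, forall_mem_support_mul_X_pow] at ht
      -- Both saturations are ideals, so it is enough to treat the monomials of `f`.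
      rw [f.as_sum]
      refine Ideal.sum_mem _ fun a ha => ?_
      rw [← mul_one (coeff a f), ← C_mul_monomial]
      refine Ideal.mul_mem_left _ _ ((mem_saturation_span_iff (hfin i)).2 ?_)
      rintro _ ⟨j, hj, rfl⟩
      obtain ⟨s, hs⟩ := h i a ⟨t, ht a ha⟩ j hj
      exact ⟨s, by rw [monomial_mul_X_pow]; exact hs⟩

/-! ### Truncations -/

theorem monomial_mem_truncation_iff {e : ℕ} {a : Fin n →₀ ℕ} :
    monomial a (1 : k) ∈ truncation I e ↔ a ∈ exponents I ∧ e ≤ a.degree := by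
  classical
  have h : truncation I e =
      Ideal.span ((fun a => monomial a (1 : k)) '' {a | a ∈ exponents I ∧ e ≤ a.degree}) := by
    refine congrArg Ideal.span (Set.ext fun f => ⟨?_, ?_⟩)
    · rintro ⟨a, hdeg, rfl, ha⟩
      exact ⟨a, ⟨ha, hdeg⟩, rfl⟩
    · rintro ⟨a, ⟨ha, hdeg⟩, rfl⟩
      exact ⟨a, hdeg, rfl, ha⟩
  rw [h, mem_ideal_span_monomial_image, support_monomial, if_neg one_ne_zero]
  constructor
  · intro H
    obtain ⟨b, ⟨hb, hdeg⟩, hle⟩ := H a (Finset.mem_singleton_self a)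
    exact ⟨isUpperSet_exponents I hle hb, hdeg.trans (Finsupp.degree_mono hle)⟩
  · rintro H b hb
    rw [Finset.mem_singleton.1 hb]
    exact ⟨a, H, le_rfl⟩

theorem isStable_truncation_iff {e : ℕ} :
    IsStable (truncation I e) ↔ ∀ a ∈ exponents I, e ≤ a.degree → ∀ m : Fin n,
      IsGreatest {j : Fin n | a j ≠ 0} m →
        ∀ i < m, Finsupp.single i 1 + (a - Finsupp.single m 1) ∈ exponents I := by
  constructor
  · intro h a ha hdeg m hm i hi
    exact (monomial_mem_truncation_iff.1
      (h a (monomial_mem_truncation_iff.2 ⟨ha, hdeg⟩) m hm i hi)).1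
  · intro h a ha m hm i hi
    obtain ⟨ha, hdeg⟩ := monomial_mem_truncation_iff.1 ha
    refine monomial_mem_truncation_iff.2 ⟨h a ha hdeg m hm i hi, hdeg.trans_eq ?_⟩
    have hle : Finsupp.single m 1 ≤ a := by
      simpa [Nat.one_le_iff_ne_zero] using hm.1
    conv_lhs => rw [← tsub_add_cancel_of_le hle]
    simp only [map_add, Finsupp.degree_single, add_comm]

theorem eventually_isStable_truncation_iff :
    (∀ᶠ e : ℕ in Filter.atTop, IsStable (truncation I e)) ↔
      ∃ e : ℕ, ∀ a ∈ exponents I, e ≤ a.degree → ∀ m : Fin n, IsGreatest {j : Fin n | a j ≠ 0} m →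
        ∀ i < m, Finsupp.single i 1 + (a - Finsupp.single m 1) ∈ exponents I := by
  simp only [isStable_truncation_iff]
  constructor
  · exact fun h => h.exists
  · rintro ⟨e, he⟩
    filter_upwards [Filter.eventually_ge_atTop e] with d hd a ha hdeg
    exact he a ha (hd.trans hdeg)

/-! ### Annihilators of variables in monomial quotients -/

/-- In a quotient `Q` of the polynomial ring by the monomial ideal with exponent set `U`, the
annihilator of `x_i` has as a `k`-basis the monomials that lie outside `U` and are multiplied
into `U` by `x_i`; it has finite length if and only if they are finite in number. -/
theorem isFiniteLength_torsionBy_X_iff {Q : Type*} [AddCommGroup Q]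
    [Module (MvPolynomial (Fin n) k) Q]
    (π : MvPolynomial (Fin n) k →ₗ[MvPolynomial (Fin n) k] Q) (hπ : Function.Surjective π)
    {U : Set (Fin n →₀ ℕ)} (hker : ∀ f, π f = 0 ↔ ∀ a ∈ f.support, a ∈ U) (i : Fin n) :
    IsFiniteLength (MvPolynomial (Fin n) k)
        (Submodule.torsionBy (MvPolynomial (Fin n) k) Q (X i : MvPolynomial (Fin n) k)) ↔
      {a | a ∉ U ∧ a + Finsupp.single i 1 ∈ U}.Finite := by
  classical
  set T := Submodule.torsionBy (MvPolynomial (Fin n) k) Q (X i : MvPolynomial (Fin n) k) with hT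
  have hmemT : ∀ f, π f ∈ T ↔ ∀ a ∈ f.support, a + Finsupp.single i 1 ∈ U := by
    intro f
    rw [hT, Submodule.mem_torsionBy_iff, ← map_smul, hker, smul_eq_mul, mul_comm,
      ← forall_mem_support_mul_X_pow, pow_one]
  rw [isFiniteLength_iff_isNoetherian_isArtinian]
  constructor
  · rintro ⟨-, _⟩
    -- The images `N d` of the `d`-th powers of the maximal ideal cut a descending chain in `T`.
    let N : ℕ →o (Submodule (MvPolynomial (Fin n) k) T)ᵒᵈ :=
      ⟨fun d => OrderDual.toDual
        ((Submodule.map π (idealOfVars (Fin n) k ^ d)).submoduleOf T),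
        fun d e hde => OrderDual.toDual_le_toDual.2 (Submodule.comap_mono
          (Submodule.map_mono (Ideal.pow_le_pow_right hde)))⟩
    obtain ⟨d, hd⟩ := IsArtinian.monotone_stabilizes N
    refine (Finsupp.finite_of_degree_lt d).subset ?_
    rintro b ⟨hbU, hb⟩
    by_contra hdeg
    have hdeg : d ≤ b.degree := not_lt.1 hdeg
    have hbT : π (monomial b 1) ∈ T := by
      rw [hmemT, support_monomial, if_neg one_ne_zero]
      simpa using hb
    have h1 : (⟨_, hbT⟩ : T) ∈ OrderDual.ofDual (N d) :=
      ⟨_, (monomial_mem_pow_idealOfVars_iff d b one_ne_zero).2 hdeg, rfl⟩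
    rw [hd (b.degree + 1) (by omega)] at h1
    obtain ⟨f, hf, hfb⟩ := h1
    have hfb : π (monomial b 1 - f) = 0 := by
      rw [map_sub, sub_eq_zero]
      exact hfb.symm
    have hfcoeff : coeff b f = 0 :=
      (mem_pow_idealOfVars_iff' _ f).1 hf b (Nat.lt_succ_self _)
    refine hbU ((hker _).1 hfb b ?_)
    simp [mem_support_iff, hfcoeff]
  · intro hfin
    let _ : Module k Q := Module.compHom Q (algebraMap k (MvPolynomial (Fin n) k))
    have _ : IsScalarTower k (MvPolynomial (Fin n) k) Q :=
      ⟨fun c f q => by rw [Algebra.smul_def, mul_smul]; rfl⟩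
    set W : Submodule k Q := Submodule.span k
      ((fun a => π (monomial a 1)) '' {a | a ∉ U ∧ a + Finsupp.single i 1 ∈ U}) with hW
    have _ : FiniteDimensional k W := FiniteDimensional.span_of_finite k (hfin.image _)
    have hTW : T.restrictScalars k ≤ W := by
      intro q hq
      obtain ⟨f, rfl⟩ := hπ q
      have hf := (hmemT f).1 hq
      rw [f.as_sum, map_sum]
      refine Submodule.sum_mem _ fun a ha => ?_
      have hsmul : π (monomial a (coeff a f)) = coeff a f • π (monomial a 1) := by
        rw [← mul_one (coeff a f), ← C_mul_monomial, ← smul_eq_mul, map_smul, mul_one]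
        rfl
      rw [hsmul]
      refine Submodule.smul_mem _ _ ?_
      by_cases haU : a ∈ U
      · have : π (monomial a 1) = 0 := by
          rw [hker, support_monomial, if_neg one_ne_zero]
          simpa using haU
        rw [this]
        exact zero_mem _
      · exact Submodule.subset_span ⟨a, ⟨haU, hf a ha⟩, rfl⟩
    have hfd : FiniteDimensional k (T.restrictScalars k) := Submodule.finiteDimensional_of_le hTW
    have hfd : FiniteDimensional k T := hfd
    exact ⟨isNoetherian_of_tower k inferInstance, isArtinian_of_tower k inferInstance⟩

/-- The kernel of the composite `S → (S/I) / (x_l : l ∈ s)(S/I)` is the monomial ideal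
`I + (x_l : l ∈ s)`. -/
theorem mkQ_mkQ_eq_zero_iff (hI : IsMonomialIdeal I) (s : Set (Fin n))
    (f : MvPolynomial (Fin n) k) :
    ((Ideal.span (X '' s : Set (MvPolynomial (Fin n) k)) •
        (⊤ : Submodule (MvPolynomial (Fin n) k) (MvPolynomial (Fin n) k ⧸ I))).mkQ ∘ₗ
          Submodule.mkQ I) f = 0 ↔
      ∀ a ∈ f.support, a ∈ exponents I ∪ {a | ∃ l ∈ s, a l ≠ 0} := by
  classical
  have htop : (⊤ : Submodule (MvPolynomial (Fin n) k) (MvPolynomial (Fin n) k ⧸ I)) =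
      Submodule.map (Submodule.mkQ I) ⊤ := by
    rw [Submodule.map_top, Submodule.range_mkQ]
  rw [LinearMap.comp_apply, Submodule.mkQ_apply, Submodule.Quotient.mk_eq_zero, htop,
    ← Submodule.map_smul'', ← Submodule.mem_comap, Submodule.comap_map_mkQ, smul_eq_mul,
    Ideal.mul_top]
  constructor
  · intro hf a ha
    obtain ⟨g, hg, h, hh, rfl⟩ := Submodule.mem_sup.1 hf
    rcases Finset.mem_union.1 (support_add ha) with h1 | h1
    · exact Or.inl ((hI.mem_iff g).1 hg a h1)
    · exact Or.inr (mem_ideal_span_X_image.1 hh a h1)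
  · intro hf
    rw [f.as_sum]
    refine Submodule.sum_mem _ fun a ha => ?_
    rcases hf a ha with h1 | h1
    · refine Submodule.mem_sup_left ((hI.mem_iff _).2 fun b hb => ?_)
      rwa [Finset.mem_singleton.1 (support_monomial_subset hb)]
    · refine Submodule.mem_sup_right (mem_ideal_span_X_image.2 fun b hb => ?_)
      rwa [Finset.mem_singleton.1 (support_monomial_subset hb)]

theorem isFiniteLength_torsionBy_quotient_iff (hI : IsMonomialIdeal I) (m : Fin n) :
    IsFiniteLength (MvPolynomial (Fin n) k)
      (Submodule.torsionBy (MvPolynomial (Fin n) k) ((MvPolynomial (Fin n) k ⧸ I) ⧸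
        (Ideal.span (X '' Set.Ioi m : Set (MvPolynomial (Fin n) k)) •
          (⊤ : Submodule (MvPolynomial (Fin n) k) (MvPolynomial (Fin n) k ⧸ I))))
        (X m : MvPolynomial (Fin n) k)) ↔ (socleSet (exponents I) m).Finite := by
  refine (isFiniteLength_torsionBy_X_iff (Submodule.mkQ _ ∘ₗ Submodule.mkQ I)
    ((Submodule.mkQ_surjective _).comp (Submodule.mkQ_surjective I))
    (mkQ_mkQ_eq_zero_iff hI _) m).trans (iff_of_eq (congrArg Set.Finite ?_))
  ext b
  have hb : (∀ l, m < l → b l = 0) ↔ ¬ ∃ l ∈ Set.Ioi m, b l ≠ 0 := by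
    simp
  have hb' : (∃ l ∈ Set.Ioi m, (b + Finsupp.single m 1 : Fin n →₀ ℕ) l ≠ 0) ↔
      ∃ l ∈ Set.Ioi m, b l ≠ 0 := by
    refine exists_congr fun l => and_congr_right fun hl => ?_
    rw [Finsupp.add_apply, Finsupp.single_eq_of_ne (Set.mem_Ioi.1 hl).ne', add_zero]
  simp only [socleSet, Set.mem_ofPred_eq, Set.mem_union, hb, hb']
  generalize (∃ l ∈ Set.Ioi m, b l ≠ 0) = p
  tauto

/-- Almost regularity of `x_n, …, x_1` on `S/I` says that for each `m` only finitely many monomials in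
`x_1, …, x_m` lie outside `I` and are multiplied into `I` by `x_m`. -/
theorem isAlmostRegularSeq_descVars_iff (hI : IsMonomialIdeal I) :
    IsAlmostRegularSeq (MvPolynomial (Fin n) k ⧸ I) (descVars k n 0) ↔
      ∀ m, (socleSet (exponents I) m).Finite := by
  have key : ∀ i : Fin (n - 0), IsFiniteLength (MvPolynomial (Fin n) k)
      (Submodule.torsionBy (MvPolynomial (Fin n) k) ((MvPolynomial (Fin n) k ⧸ I) ⧸
        (Ideal.span (descVars k n 0 '' Set.Iio i) •
          (⊤ : Submodule (MvPolynomial (Fin n) k) (MvPolynomial (Fin n) k ⧸ I))))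
        (descVars k n 0 i)) ↔ (socleSet (exponents I) (Fin.rev i)).Finite := by
    intro i
    have himage : descVars k n 0 '' Set.Iio i = X '' Set.Ioi (Fin.rev i : Fin n) := by
      ext f
      constructor
      · rintro ⟨j, hj, rfl⟩
        exact ⟨Fin.rev j, Fin.rev_lt_rev.2 hj, rfl⟩
      · rintro ⟨l, hl, rfl⟩
        exact ⟨Fin.rev l, Fin.rev_lt_iff.1 hl, congrArg X (Fin.rev_rev l)⟩
    rw [himage]
    exact isFiniteLength_torsionBy_quotient_iff hI (Fin.rev i)
  refine (forall_congr' key).trans ⟨fun h m => ?_, fun h i => h _⟩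
  have := h (Fin.rev m)
  rwa [Fin.rev_rev] at this

end Translation

/-! ### Extension by zero of Koszul chains -/

section Koszul

variable {R : Type*} [CommRing R] {M : Type*} [AddCommGroup M] [Module R M]

section Extend

variable {ι κ : Type*} [LinearOrder ι] [LinearOrder κ]

/-- The image of a `p`-element subset under an order embedding, as a `p`-element subset. -/
def mapSubset (e : ι ↪o κ) {p : ℕ} (t : {t : Finset ι // t.card = p}) :
    {s : Finset κ // s.card = p} :=
  ⟨t.1.map e.toEmbedding, by rw [Finset.card_map, t.2]⟩

theorem mapSubset_injective (e : ι ↪o κ) (p : ℕ) :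
    Function.Injective (mapSubset e : {t : Finset ι // t.card = p} → _) := fun _ _ h =>
  Subtype.ext (Finset.map_injective e.toEmbedding (congrArg Subtype.val h))

/-- Extension of Koszul chains by zero along an order embedding of the index sets. For a
subfamily `y ∘ e` of `y` this is the inclusion of the exterior algebra on the smaller basis. -/
noncomputable def koszulExtend (R : Type*) [CommRing R] (M : Type*) [AddCommGroup M] [Module R M]
    (e : ι ↪o κ) (p : ℕ) : KoszulTerm ι M p →ₗ[R] KoszulTerm κ M p where
  toFun f := Function.extend (mapSubset e) f 0
  map_add' f g := by
    rw [← Function.extend_add, add_zero]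
  map_smul' c f := by
    rw [RingHom.id_apply, ← Function.extend_smul, smul_zero]

theorem koszulExtend_mapSubset (e : ι ↪o κ) {p : ℕ} (f : KoszulTerm ι M p)
    (t : {t : Finset ι // t.card = p}) : koszulExtend R M e p f (mapSubset e t) = f t :=
  (mapSubset_injective e p).extend_apply f 0 t

theorem koszulExtend_of_notMem (e : ι ↪o κ) {p : ℕ} (f : KoszulTerm ι M p)
    {s : {s : Finset κ // s.card = p}} {j : κ} (hj : j ∈ s.1) (hje : j ∉ Set.range e) :
    koszulExtend R M e p f s = 0 := by
  refine Function.extend_apply' f (0 : KoszulTerm κ M p) s ?_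
  rintro ⟨t, rfl⟩
  obtain ⟨i, -, hi⟩ := Finset.mem_map.1 hj
  exact hje ⟨i, hi⟩

variable (R M) in
theorem koszulExtend_injective (e : ι ↪o κ) (p : ℕ) :
    Function.Injective (koszulExtend R M e p) := fun f g h => funext fun t => by
  rw [← koszulExtend_mapSubset (R := R) e f, h, koszulExtend_mapSubset]

theorem koszulSign_map (e : ι ↪o κ) (t : Finset ι) (j : ι) :
    koszulSign (t.map e.toEmbedding) (e j) = koszulSign t j := by
  rw [koszulSign, koszulSign, Finset.filter_map, Finset.card_map]
  congr 3
  ext i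
  simp

theorem exists_mem_notMem_range (e : ι ↪o κ) {p : ℕ} {s : {s : Finset κ // s.card = p}}
    (hs : s ∉ Set.range (mapSubset e)) : ∃ j ∈ s.1, j ∉ Set.range e := by
  by_contra! h
  have hmap : (s.1.preimage e e.injective.injOn).map e.toEmbedding = s.1 := by
    ext j
    simp only [Finset.mem_map, Finset.mem_preimage]
    constructor
    · rintro ⟨i, hi, rfl⟩
      exact hi
    · intro hj
      obtain ⟨i, rfl⟩ := h j hj
      exact ⟨i, hj, rfl⟩
  refine hs ⟨⟨s.1.preimage e e.injective.injOn, ?_⟩, Subtype.ext hmap⟩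
  rw [← Finset.card_map e.toEmbedding, hmap, s.2]

/-- Extension by zero is a map of Koszul complexes. -/
theorem koszulD_koszulExtend [Fintype ι] [Fintype κ] (e : ι ↪o κ) (y : κ → R) (p : ℕ)
    (f : KoszulTerm ι M (p + 1)) :
    koszulD y M p (koszulExtend R M e (p + 1) f) =
      koszulExtend R M e p (koszulD (y ∘ e) M p f) := by
  funext s
  by_cases hs : s ∈ Set.range (mapSubset e)
  · obtain ⟨t, rfl⟩ := hs
    rw [koszulExtend_mapSubset]
    simp only [koszulD, LinearMap.coe_mk, AddHom.coe_mk]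
    symm
    refine Fintype.sum_of_injective
      (fun j : {j : ι // j ∉ t.1} => (⟨e j.1, fun h => by
        obtain ⟨i, hi, hij⟩ := Finset.mem_map.1 h
        exact j.2 (e.injective hij ▸ hi)⟩ : {j : κ // j ∉ (mapSubset e t).1}))
      (fun i j h => Subtype.ext (e.injective (congrArg Subtype.val h))) _ _ ?_ ?_
    · rintro ⟨j, hj⟩ hjr
      rw [koszulExtend_of_notMem e f (Finset.mem_insert_self j _), smul_zero, smul_zero]
      rintro ⟨i, rfl⟩
      exact hjr ⟨⟨i, fun hi => hj (Finset.mem_map_of_mem _ hi)⟩, rfl⟩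
    · rintro ⟨j, hj⟩
      have h1 : koszulSign (mapSubset e t).1 (e j) = koszulSign t.1 j := koszulSign_map e t.1 j
      rw [h1, Function.comp_apply, ← koszulExtend_mapSubset (R := R) e f]
      exact congrArg (fun s => koszulSign t.1 j • (y (e j) • koszulExtend R M e (p + 1) f s))
        (Subtype.ext (Finset.map_insert e.toEmbedding j t.1))
  · obtain ⟨j, hj, hje⟩ := exists_mem_notMem_range e hs
    rw [koszulExtend_of_notMem e _ hj hje]
    simp only [koszulD, LinearMap.coe_mk, AddHom.coe_mk]
    refine Finset.sum_eq_zero fun i _ => ?_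
    rw [koszulExtend_of_notMem e f (Finset.mem_insert_of_mem hj) hje, smul_zero, smul_zero]

end Extend

/-! ### First Koszul homology -/

theorem mem_koszulCycles_one_iff {ι : Type*} [LinearOrder ι] [Fintype ι] (y : ι → R)
    (f : KoszulTerm ι M 1) :
    f ∈ koszulCycles y M 1 ↔ ∑ j, y j • f ⟨{j}, Finset.card_singleton j⟩ = 0 := by
  have h : koszulD y M 0 f ⟨∅, rfl⟩ = ∑ j, y j • f ⟨{j}, Finset.card_singleton j⟩ := by
    simp only [koszulD, LinearMap.coe_mk, AddHom.coe_mk]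
    refine Fintype.sum_equiv (Equiv.subtypeUnivEquiv fun j => Finset.notMem_empty j) _ _ ?_
    rintro ⟨j, hj⟩
    simp [koszulSign]
  rw [← h, koszulCycles, LinearMap.mem_ker]
  refine ⟨fun h => congrFun h _, fun h => funext ?_⟩
  rintro ⟨s, hs⟩
  obtain rfl := Finset.card_eq_zero.1 hs
  exact h

theorem koszulBoundaries_le_koszulCycles {ι : Type*} [LinearOrder ι] [Fintype ι] (y : ι → R) :
    koszulBoundaries y M 1 ≤ koszulCycles y M 1 := by
  rintro _ ⟨g, rfl⟩
  exact LinearMap.congr_fun (koszulD_comp_koszulD y M 0) g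

variable {r : ℕ}

/-- The last coefficient of a Koszul `1`-chain. -/
def lastCoeff (R : Type*) [CommRing R] (M : Type*) [AddCommGroup M] [Module R M] (r : ℕ) :
    KoszulTerm (Fin (r + 1)) M 1 →ₗ[R] M :=
  LinearMap.proj ⟨{Fin.last r}, Finset.card_singleton _⟩

/-- The submodule `(y_0, …, y_{r-1}) M`. -/
abbrev initSMul (M : Type*) [AddCommGroup M] [Module R M] (y : Fin (r + 1) → R) : Submodule R M :=
  Ideal.span (y '' Set.Iio (Fin.last r)) • (⊤ : Submodule R M)

/-- The last coefficients of the `1`-boundaries are the elements of `(y_0, …, y_{r-1}) M`. -/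
theorem map_lastCoeff_koszulBoundaries (y : Fin (r + 1) → R) :
    (koszulBoundaries y M 1).map (lastCoeff R M r) = initSMul M y := by
  have hsign : ∀ j, koszulSign {Fin.last r} j = 1 := fun j => by
    rw [koszulSign, Finset.filter_singleton, if_neg (Fin.le_last j).not_gt]
    rfl
  refine le_antisymm ?_ ?_
  · rintro _ ⟨_, ⟨g, rfl⟩, rfl⟩
    simp only [lastCoeff, LinearMap.proj_apply, koszulD, LinearMap.coe_mk, AddHom.coe_mk, hsign,
      one_smul]
    refine Submodule.sum_mem _ fun j _ => Submodule.smul_mem_smul (Ideal.subset_span ?_) trivial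
    exact ⟨j, Fin.lt_last_iff_ne_last.2 fun h => j.2 (by simp [h]), rfl⟩
  · refine Submodule.smul_le.2 fun a ha m _ => ?_
    suffices h : Ideal.span (y '' Set.Iio (Fin.last r)) ≤
        ((koszulBoundaries y M 1).map (lastCoeff R M r)).comap (LinearMap.toSpanSingleton R M m) from
      h ha
    rw [Ideal.span_le]
    rintro _ ⟨j, hj, rfl⟩
    have hjl : j ∉ ({Fin.last r} : Finset (Fin (r + 1))) := fun h =>
      (Set.mem_Iio.1 hj).ne (Finset.mem_singleton.1 h)
    -- The boundary of `m • (e_j ∧ e_r)` has last coefficient `y_j m`.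
    refine ⟨_, ⟨Pi.single ⟨insert j {Fin.last r}, by
      rw [Finset.card_insert_of_notMem hjl, Finset.card_singleton]⟩ m, rfl⟩, ?_⟩
    simp only [lastCoeff, LinearMap.proj_apply, koszulD, LinearMap.coe_mk, AddHom.coe_mk, hsign,
      one_smul, LinearMap.toSpanSingleton_apply]
    rw [Finset.sum_eq_single ⟨j, hjl⟩]
    · rw [Pi.single_eq_same]
    · rintro ⟨i, hi⟩ - hij
      rw [Pi.single_eq_of_ne, smul_zero]
      intro h
      have hmem : i ∈ insert j {Fin.last r} :=
        (Finset.ext_iff.1 (congrArg Subtype.val h) i).1 (Finset.mem_insert_self i _)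
      rcases Finset.mem_insert.1 hmem with h | h
      · exact hij (Subtype.ext h)
      · exact hi h
    · exact fun h => absurd (Finset.mem_univ _) h

theorem lastCoeff_koszulExtend (g : KoszulTerm (Fin r) M 1) :
    lastCoeff R M r (koszulExtend R M Fin.castSuccOrderEmb 1 g) = 0 :=
  koszulExtend_of_notMem (R := R) _ _ (Finset.mem_singleton_self _) (by
    rintro ⟨i, hi⟩
    exact (Fin.castSucc_lt_last i).ne hi)

theorem exists_koszulExtend_eq (f : KoszulTerm (Fin (r + 1)) M 1) (hf : lastCoeff R M r f = 0) :
    ∃ g, koszulExtend R M Fin.castSuccOrderEmb 1 g = f := by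
  refine ⟨fun t => f (mapSubset Fin.castSuccOrderEmb t), funext fun s => ?_⟩
  by_cases hs : s ∈ Set.range (mapSubset (Fin.castSuccOrderEmb : Fin r ↪o Fin (r + 1)))
  · obtain ⟨t, rfl⟩ := hs
    rw [koszulExtend_mapSubset]
  · obtain ⟨j, hj, hje⟩ := exists_mem_notMem_range _ hs
    rw [koszulExtend_of_notMem _ _ hj hje]
    obtain rfl : j = Fin.last r := by
      by_contra hlast
      exact hje ⟨j.castPred hlast, Fin.castSucc_castPred j hlast⟩
    obtain ⟨s, hs1⟩ := s
    obtain ⟨i, rfl⟩ := Finset.card_eq_one.1 hs1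
    obtain rfl := Finset.mem_singleton.1 hj
    exact hf.symm

theorem exists_sum_smul_eq_of_mem {y : Fin (r + 1) → R} {m : M} (hm : m ∈ initSMul M y) :
    ∃ c : Fin r → M, ∑ j, y j.castSucc • c j = m := by
  let φ : (Fin r → M) →ₗ[R] M := ∑ j, y j.castSucc • LinearMap.proj j
  have hφ : ∀ c, φ c = ∑ j, y j.castSucc • c j := fun c => by simp [φ]
  suffices h : initSMul M y ≤ LinearMap.range φ by
    obtain ⟨c, hc⟩ := h hm
    exact ⟨c, (hφ c).symm.trans hc⟩
  refine Submodule.smul_le.2 fun a ha m _ => ?_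
  suffices h : Ideal.span (y '' Set.Iio (Fin.last r)) ≤
      (LinearMap.range φ).comap (LinearMap.toSpanSingleton R M m) from h ha
  rw [Ideal.span_le]
  rintro _ ⟨j, hj, rfl⟩
  have hjl : j ≠ Fin.last r := (Set.mem_Iio.1 hj).ne
  refine ⟨Pi.single (j.castPred hjl) m, ?_⟩
  rw [hφ, Finset.sum_eq_single (j.castPred hjl)]
  · simp
  · intro i _ hi
    rw [Pi.single_eq_of_ne hi, smul_zero]
  · exact fun h => absurd (Finset.mem_univ _) h

theorem smul_lastCoeff_mem {y : Fin (r + 1) → R} {f : KoszulTerm (Fin (r + 1)) M 1}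
    (hf : f ∈ koszulCycles y M 1) : y (Fin.last r) • lastCoeff R M r f ∈ initSMul M y := by
  rw [mem_koszulCycles_one_iff, Fin.sum_univ_castSucc] at hf
  have h := eq_neg_of_add_eq_zero_right hf
  change y (Fin.last r) • f _ ∈ _
  rw [h]
  refine neg_mem (Submodule.sum_mem _ fun j _ => Submodule.smul_mem_smul (Ideal.subset_span ?_)
    trivial)
  exact ⟨_, Fin.castSucc_lt_last j, rfl⟩

/-- The connecting map `H_1(y_0, …, y_r; M) → 0 :_{M / (y_0, …, y_{r-1}) M} y_r`, which sends the
class of a cycle to the class of its last coefficient. -/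
def koszulHomologyToTorsion (M : Type*) [AddCommGroup M] [Module R M] (y : Fin (r + 1) → R) :
    KoszulHomology y M 1 →ₗ[R] Submodule.torsionBy R (M ⧸ initSMul M y) (y (Fin.last r)) :=
  Submodule.liftQ _
    (LinearMap.codRestrict _
      ((initSMul M y).mkQ ∘ₗ lastCoeff R M r ∘ₗ (koszulCycles y M 1).subtype) fun f => by
        rw [Submodule.mem_torsionBy_iff, ← map_smul]
        exact (Submodule.Quotient.mk_eq_zero _).2 (smul_lastCoeff_mem f.2))
    (by
      rintro ⟨f, hf⟩ hfb
      refine Subtype.ext ((Submodule.Quotient.mk_eq_zero _).2 ?_)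
      exact (map_lastCoeff_koszulBoundaries y).le ⟨f, hfb, rfl⟩)

theorem koszulHomologyToTorsion_mk_eq_zero_iff {y : Fin (r + 1) → R} (f : koszulCycles y M 1) :
    koszulHomologyToTorsion M y (Submodule.Quotient.mk f) = 0 ↔
      lastCoeff R M r f ∈ initSMul M y :=
  Subtype.ext_iff.trans (Submodule.Quotient.mk_eq_zero _)

theorem koszulHomologyToTorsion_surjective (y : Fin (r + 1) → R) :
    Function.Surjective (koszulHomologyToTorsion M y) := by
  rintro ⟨q, hq⟩
  obtain ⟨m, rfl⟩ := Submodule.mkQ_surjective _ q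
  rw [Submodule.mem_torsionBy_iff, ← map_smul, Submodule.mkQ_apply,
    Submodule.Quotient.mk_eq_zero] at hq
  obtain ⟨c, hc⟩ := exists_sum_smul_eq_of_mem hq
  -- The chain with coefficients `-c` and `m`; a function `v` of the index gives the chain
  -- `s ↦ ∑ j ∈ s, v j` on singletons.
  let v : Fin (r + 1) → M := Fin.snoc (-c) m
  have hv : (fun s => ∑ j ∈ s.1, v j : KoszulTerm (Fin (r + 1)) M 1) ∈ koszulCycles y M 1 := by
    rw [mem_koszulCycles_one_iff, Fin.sum_univ_castSucc]
    simp [v, hc]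
  refine ⟨Submodule.Quotient.mk ⟨_, hv⟩, Subtype.ext (congrArg (Submodule.mkQ _) ?_)⟩
  change ∑ j ∈ {Fin.last r}, v j = m
  simp [v]

/-- The map `H_1(y_0, …, y_{r-1}; M) → H_1(y_0, …, y_r; M)` induced by extension by zero. -/
noncomputable def koszulHomologyExtend (M : Type*) [AddCommGroup M] [Module R M] (y : Fin (r + 1) → R) :
    KoszulHomology (y ∘ Fin.castSucc) M 1 →ₗ[R] KoszulHomology y M 1 :=
  Submodule.mapQ _ _
    ((koszulExtend R M Fin.castSuccOrderEmb 1).restrict fun f hf => by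
      change koszulD y M 0 _ = 0
      rw [koszulD_koszulExtend]
      exact (congrArg _ hf).trans (map_zero _))
    (by
      rintro ⟨_, hf⟩ ⟨g, rfl⟩
      exact ⟨koszulExtend R M Fin.castSuccOrderEmb 2 g, koszulD_koszulExtend _ y 1 g⟩)

/-- Exactness of `H_1(y_0, …, y_{r-1}; M) → H_1(y_0, …, y_r; M) → 0 :_{M / (y_0, …, y_{r-1}) M} y_r`:
a cycle whose last coefficient lies in `(y_0, …, y_{r-1}) M` differs by a boundary from one whose
last coefficient is zero. -/
theorem range_koszulHomologyExtend (y : Fin (r + 1) → R) :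
    LinearMap.range (koszulHomologyExtend M y) = LinearMap.ker (koszulHomologyToTorsion M y) := by
  ext z
  constructor
  · rintro ⟨w, rfl⟩
    obtain ⟨⟨g, hg⟩, rfl⟩ := Submodule.mkQ_surjective _ w
    refine (koszulHomologyToTorsion_mk_eq_zero_iff _).2 ?_
    change lastCoeff R M r (koszulExtend R M Fin.castSuccOrderEmb 1 g) ∈ _
    rw [lastCoeff_koszulExtend]
    exact zero_mem _
  · intro hz
    obtain ⟨⟨f, hf⟩, rfl⟩ := Submodule.mkQ_surjective _ z
    have hlast := (koszulHomologyToTorsion_mk_eq_zero_iff _).1 hz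
    rw [← map_lastCoeff_koszulBoundaries] at hlast
    obtain ⟨b, hb, hbf⟩ := hlast
    obtain ⟨g, hg⟩ := exists_koszulExtend_eq (f - b) (by rw [map_sub, hbf, sub_self])
    have hgc : g ∈ koszulCycles (y ∘ Fin.castSucc) M 1 := by
      refine koszulExtend_injective R M Fin.castSuccOrderEmb 0 ?_
      have h1 := koszulD_koszulExtend Fin.castSuccOrderEmb y 0 g
      rw [hg] at h1
      refine h1.symm.trans (Eq.trans ?_ (map_zero _).symm)
      exact sub_mem hf (koszulBoundaries_le_koszulCycles y hb)
    refine ⟨Submodule.Quotient.mk ⟨g, hgc⟩, (Submodule.Quotient.eq _).2 ?_⟩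
    change koszulExtend R M Fin.castSuccOrderEmb 1 g - f ∈ koszulBoundaries y M 1
    rw [hg, sub_sub_cancel_left]
    exact neg_mem hb

/-! ### Almost regular sequences and Koszul homology -/

theorem isAlmostRegularSeq_succ_iff (y : Fin (r + 1) → R) :
    IsAlmostRegularSeq M y ↔ IsAlmostRegularSeq M (y ∘ Fin.castSucc) ∧
      IsFiniteLength R (Submodule.torsionBy R (M ⧸ initSMul M y) (y (Fin.last r))) := by
  refine Fin.forall_fin_succ'.trans (and_congr_left fun _ => forall_congr' fun i => ?_)
  have h : (y ∘ Fin.castSucc) '' Set.Iio i = y '' Set.Iio (Fin.castSucc i) := by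
    rw [Set.image_comp]
    congr 1
    ext j
    constructor
    · rintro ⟨l, hl, rfl⟩
      exact Fin.castSucc_lt_castSucc_iff.2 hl
    · intro hj
      have hne : j ≠ Fin.last r := ((Set.mem_Iio.1 hj).trans (Fin.castSucc_lt_last i)).ne
      exact ⟨j.castPred hne, Fin.castSucc_lt_castSucc_iff.1 (by simpa using hj), by simp⟩
  rw [h]
  rfl

theorem isFiniteLength_koszulHomology_zero (y : Fin 0 → R) :
    IsFiniteLength R (KoszulHomology y M 1) := by
  have : IsEmpty {s : Finset (Fin 0) // s.card = 1} := ⟨fun s => by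
    have := s.2
    rw [Finset.eq_empty_of_isEmpty s.1] at this
    simp at this⟩
  have : Subsingleton (KoszulHomology y M 1) := Quotient.instSubsingletonQuotient _
  exact .of_subsingleton

/-- Over any commutative ring, a sequence is almost regular on `M` if and only if the first Koszul
homology of each of its initial segments has finite length: the exact sequence
`H_1(y_0, …, y_{r-1}; M) → H_1(y_0, …, y_r; M) → 0 :_{M / (y_0, …, y_{r-1}) M} y_r → 0` gives the
induction step. -/
theorem isAlmostRegularSeq_iff_koszulHomology (y : Fin r → R) :
    IsAlmostRegularSeq M y ↔ ∀ (t : ℕ) (ht : t ≤ r),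
      IsFiniteLength R (KoszulHomology (y ∘ Fin.castLE ht) M 1) := by
  induction r with
  | zero =>
    refine ⟨fun _ t ht => ?_, fun _ i => i.elim0⟩
    obtain rfl := Nat.le_zero.1 ht
    exact isFiniteLength_koszulHomology_zero _
  | succ r ih =>
    have hsplit : (∀ (t : ℕ) (ht : t ≤ r + 1),
        IsFiniteLength R (KoszulHomology (y ∘ Fin.castLE ht) M 1)) ↔
        (∀ (t : ℕ) (ht : t ≤ r),
          IsFiniteLength R (KoszulHomology ((y ∘ Fin.castSucc) ∘ Fin.castLE ht) M 1)) ∧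
        IsFiniteLength R (KoszulHomology y M 1) := by
      refine ⟨fun h => ⟨fun t ht => h t (ht.trans r.le_succ), h (r + 1) le_rfl⟩, ?_⟩
      rintro ⟨h1, h2⟩ t ht
      rcases ht.lt_or_eq with hlt | rfl
      · exact h1 t (Nat.lt_succ_iff.1 hlt)
      · exact h2
    rw [isAlmostRegularSeq_succ_iff, hsplit, ih]
    refine and_congr_right fun h => ⟨fun hT => ?_, fun hH => ?_⟩
    · have h' : IsFiniteLength R (KoszulHomology (y ∘ Fin.castSucc) M 1) := h r le_rfl
      rw [isFiniteLength_iff_isNoetherian_isArtinian] at h' hT ⊢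
      obtain ⟨_, _⟩ := h'
      obtain ⟨_, _⟩ := hT
      exact ⟨isNoetherian_of_range_eq_ker _ _ (range_koszulHomologyExtend y),
        isArtinian_of_range_eq_ker _ _ (range_koszulHomologyExtend y)⟩
    · exact hH.of_surjective (koszulHomologyToTorsion_surjective y)

end Koszul

end BorelTypeIdeals

theorem theorem1p1 (k : Type*) [Field k] [Infinite k] (n : ℕ)
    (I : Ideal (MvPolynomial (Fin n) k)) (hI : BorelTypeIdeals.IsMonomialIdeal I) :
    List.TFAE [
      BorelTypeIdeals.IsBorelType I,
      BorelTypeIdeals.IsAlmostRegularSeq (MvPolynomial (Fin n) k ⧸ I)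
        (BorelTypeIdeals.descVars k n 0),
      ∀ i : Fin n, IsFiniteLength (MvPolynomial (Fin n) k)
        (BorelTypeIdeals.KoszulHomology (BorelTypeIdeals.descVars k n i)
          (MvPolynomial (Fin n) k ⧸ I) 1),
      ∀ᶠ e : ℕ in Filter.atTop,
        BorelTypeIdeals.IsStable (BorelTypeIdeals.truncation I e)] := by
  have hA := BorelTypeIdeals.isUpperSet_exponents I
  tfae_have 2 ↔ 3 := by
    rw [BorelTypeIdeals.isAlmostRegularSeq_iff_koszulHomology]
    refine ⟨fun h i => h (n - i) (Nat.sub_le n i), fun h t ht => ?_⟩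
    -- The initial segment of length `t > 0` is `x_n, …, x_{i + 1}` with `i = n - t`.
    rcases Nat.eq_zero_or_pos t with rfl | hpos
    · exact BorelTypeIdeals.isFiniteLength_koszulHomology_zero _
    · obtain ⟨i, hi, rfl⟩ : ∃ i, i < n ∧ t = n - i :=
        ⟨n - t, by omega, by omega⟩
      exact h ⟨i, hi⟩
  rw [BorelTypeIdeals.isBorelType_iff hI, BorelTypeIdeals.isAlmostRegularSeq_descVars_iff hI,
    BorelTypeIdeals.eventually_isStable_truncation_iff] at *
  tfae_have 1 → 2 := BorelTypeIdeals.finite_socleSet_of_forall_exists hA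
  tfae_have 2 → 4 := BorelTypeIdeals.exists_degree_bound_of_finite_socleSet hA
  tfae_have 4 → 1 := fun ⟨_, h⟩ => BorelTypeIdeals.exists_add_single_mem_of_exchange hA h
  tfae_finish
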